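/- Let $n$ be a natural number and let $A:\mathbb R^n\to\mathbb R^n$ be a linear operator. A proper cone in a finite-dimensional real vector space $V$ (with its Euclidean topology) is a closed set $K\subset V$ such that $x+y\in K$ and $\alpha x\in K$ for all $x,y\in K$ and $\alpha\ge 0$, with $K\cap(-K)=\{0\}$ and $\operatorname{int}(K)\neq\emptyset$. A totally positive structure on $\mathbb R^n$ is a family $\{K_1,\dots,K_n\}$ in which $K_j$ is a proper cone in the exterior power $\wedge^j\mathbb R^n$ for $j=1,\dots,n$ (with $\wedge^1\mathbb R^n=\mathbb R^n$). The operator $A$ is called generalized sign-regular (GSR) with respect to $\{K_1,\dots,K_n\}$ if there are $\epsilon_1,\dots,\epsilon_n\in\{1,-1\}$ such that $\epsilon_j(\wedge^jA)K_j\subseteq K_j$ for every $j=1,\dots,n$, and generalized strictly sign-regular (GSSR) with respect to $\{K_1,\dots,K_n\}$ if there are such signs with $\epsilon_j(\wedge^jA)(K_j\setminus\{0\})\subseteq\operatorname{int}(K_j)$ for every $j=1,\dots,n$. Suppose that all the (complex) eigenvalues of $A$ are real. Then there is a totally positive structure on $\mathbb R^n$ with respect to which $A$ is GSR. If, moreover,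 all the eigenvalues of $A$ are nonzero, simple (of algebraic multiplicity one) and pairwise different in absolute value, then there is a totally positive structure on $\mathbb R^n$ with respect to which $A$ is GSSR. -/

import Mathlib

open scoped Pointwise

/-- A proper cone in a finite-dimensional real vector space: a closed convex cone that is
pointed (`K ∩ (-K) = {0}`) and solid (nonempty interior). -/
structure IsProperCone {V : Type*} [AddCommGroup V] [Module ℝ V] [TopologicalSpace V]
    (K : Set V) : Prop where
  isClosed : IsClosed K
  add_mem : ∀ x ∈ K, ∀ y ∈ K, x + y ∈ K
  smul_mem : ∀ a : ℝ, 0 ≤ a → ∀ x ∈ K, a • x ∈ K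
  pointed : K ∩ -K = {0}
  solid : (interior K).Nonempty

/-- `B` is `K`-nonnegative: `B K ⊆ K`. -/
def IsConeNonneg {V : Type*} [AddCommGroup V] [Module ℝ V]
    (K : Set V) (B : V →ₗ[ℝ] V) : Prop :=
  ∀ x ∈ K, B x ∈ K

/-- `B` is `K`-positive: `B (K \ {0}) ⊆ int K`. -/
def IsConePos {V : Type*} [AddCommGroup V] [Module ℝ V] [TopologicalSpace V]
    (K : Set V) (B : V →ₗ[ℝ] V) : Prop :=
  ∀ x ∈ K \ {0}, B x ∈ interior K

/-- The space `∧ʲ ℝⁿ`. -/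
abbrev ExtPow (n j : ℕ) : Type :=
  ⋀[ℝ]^j (EuclideanSpace ℝ (Fin n))

/-- The Euclidean topology of the finite-dimensional space `∧ʲ ℝⁿ`: its module topology, which is
the only Hausdorff vector space topology on it. -/
instance ExtPow.instTopologicalSpace (n j : ℕ) : TopologicalSpace (ExtPow n j) :=
  moduleTopology ℝ (ExtPow n j)

instance ExtPow.instIsModuleTopology (n j : ℕ) : IsModuleTopology ℝ (ExtPow n j) :=
  ⟨rfl⟩

/-- A totally positive structure on `ℝⁿ`: a family of proper cones `K₁ ⊂ ∧¹ ℝⁿ = ℝⁿ`,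
`K₂ ⊂ ∧² ℝⁿ`, …, `Kₙ ⊂ ∧ⁿ ℝⁿ`. The cone in `∧ʲ ℝⁿ` (for `1 ≤ j ≤ n`) has index `j - 1`
in `Fin n`. -/
structure TotallyPositiveStructure (n : ℕ) where
  cone : ∀ i : Fin n, Set (ExtPow n (i + 1))
  isProperCone : ∀ i : Fin n, IsProperCone (cone i)

/-- `A` is generalized sign-regular with respect to the totally positive structure `K`: there are
signs `ε j = ±1` such that `ε j • ∧ʲ A` is `K j`-nonnegative for `j = 1, …, n`. -/
def IsGSRWith {n : ℕ} (K : TotallyPositiveStructure n)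
    (A : EuclideanSpace ℝ (Fin n) →ₗ[ℝ] EuclideanSpace ℝ (Fin n)) : Prop :=
  ∃ ε : Fin n → ℝ, (∀ i, ε i = 1 ∨ ε i = -1) ∧
    ∀ i : Fin n, IsConeNonneg (K.cone i) (ε i • exteriorPower.map (i + 1) A)

/-- `A` is generalized strictly sign-regular with respect to the totally positive structure `K`:
there are signs `ε j = ±1` such that `ε j • ∧ʲ A` is `K j`-positive for `j = 1, …, n`. -/
def IsGSSRWith {n : ℕ} (K : TotallyPositiveStructure n)
    (A : EuclideanSpace ℝ (Fin n) →ₗ[ℝ] EuclideanSpace ℝ (Fin n)) : Prop :=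
  ∃ ε : Fin n → ℝ, (∀ i, ε i = 1 ∨ ε i = -1) ∧
    ∀ i : Fin n, IsConePos (K.cone i) (ε i • exteriorPower.map (i + 1) A)

/-- `μ` is a (complex) eigenvalue of the real operator `A`, that is, an eigenvalue of its
complexification. -/
def IsEigenvalue {n : ℕ} (A : EuclideanSpace ℝ (Fin n) →ₗ[ℝ] EuclideanSpace ℝ (Fin n))
    (μ : ℂ) : Prop :=
  Module.End.HasEigenvalue (A.baseChange ℂ) μ

/-- `μ` is a simple eigenvalue of `A`: a root of its characteristic polynomial of
multiplicity one. -/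
def IsSimpleEigenvalue {n : ℕ} (A : EuclideanSpace ℝ (Fin n) →ₗ[ℝ] EuclideanSpace ℝ (Fin n))
    (μ : ℂ) : Prop :=
  (A.baseChange ℂ).charpoly.rootMultiplicity μ = 1

/-! The cones in different exterior powers need not be compatible, so each degree is treated
separately.

GSR: a real spectrum makes the characteristic polynomial split, so the generalized eigenspaces of
`A` span. Wedges of generalized eigenvectors are again generalized eigenvectors
(`pow_map_sub_apply_ιMulti_eq_zero`), so the same holds for each `B = ⋀ʲ A`. Among the Jordan chains
of `B`, take one with `(|μ|, length)` lexicographically maximal, and change the sign of `B` so that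
its eigenvalue becomes `|μ|`. Every orbit is then bounded by a multiple of the growth `g` of this
Jordan block, while a functional `f` positive on the chain satisfies `f (B ^ k v) ≥ c * g k` for the
top `v` of the chain. The vectors `x` with `e * ‖B ^ k x‖ ≤ f (B ^ k x)` for all `k` form the
invariant cone (`exists_isProperCone_of_orbit_bound`). Taking for `g` the exact binomial sum covers
nilpotent `B` as well.

GSSR: `A` has an eigenbasis ordered by decreasing `|l i|`, and the wedge of its first `j` vectors is
a strictly dominant eigenvector of `⋀ʲ A`. The cone on which this coordinate bounds the `ℓ¹` norm of
the others is mapped into its interior, up to sign. -/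

open Module

/-! ### Transport of cones along linear equivalences -/

/-- Proper cones pull back along linear equivalences of spaces with their module topologies. -/
theorem IsProperCone.preimage {V W : Type*} [AddCommGroup V] [Module ℝ V] [TopologicalSpace V]
    [IsModuleTopology ℝ V] [AddCommGroup W] [Module ℝ W] [TopologicalSpace W]
    [IsModuleTopology ℝ W] (φ : V ≃ₗ[ℝ] W) {K : Set W} (hK : IsProperCone K) :
    IsProperCone (φ ⁻¹' K) := by
  have hφ : Continuous φ := by
    have := IsModuleTopology.toContinuousAdd ℝ W
    exact IsModuleTopology.continuous_of_linearMap φ.toLinearMap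
  refine ⟨hK.isClosed.preimage hφ, fun x hx y hy ↦ ?_, fun a ha x hx ↦ ?_, ?_, ?_⟩
  · simpa using hK.add_mem _ hx _ hy
  · simpa using hK.smul_mem a ha _ hx
  · ext x
    have := Set.ext_iff.1 hK.pointed (φ x)
    simpa using this
  · obtain ⟨y, hy⟩ := hK.solid
    refine ⟨φ.symm y, preimage_interior_subset_interior_preimage hφ ?_⟩
    simpa using hy

theorem interior_preimage_linearEquiv {V W : Type*} [AddCommGroup V] [Module ℝ V]
    [TopologicalSpace V] [IsModuleTopology ℝ V] [AddCommGroup W] [Module ℝ W] [TopologicalSpace W]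
    [IsModuleTopology ℝ W] (φ : V ≃ₗ[ℝ] W) (K : Set W) :
    φ ⁻¹' interior K ⊆ interior (φ ⁻¹' K) := by
  have := IsModuleTopology.toContinuousAdd ℝ W
  exact preimage_interior_subset_interior_preimage
    (IsModuleTopology.continuous_of_linearMap φ.toLinearMap)

/-! ### Invariant cones from orbit bounds -/

/-- If one orbit of `B` is, when tested against a functional, comparable with the growth of all
orbits, then `B` leaves a proper cone invariant. -/
theorem exists_isProperCone_of_orbit_bound {ι : Type*} [Fintype ι]
    (B : (ι → ℝ) →ₗ[ℝ] (ι → ℝ)) (g : ℕ → ℝ) (hg0 : ∀ k, 0 ≤ g k)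
    (hub : ∀ x, ∃ C, ∀ k, ‖(B ^ k) x‖ ≤ C * g k)
    (f : (ι → ℝ) →ₗ[ℝ] ℝ) (v : ι → ℝ) (c : ℝ) (hc : 0 < c)
    (hlb : ∀ k, c * g k ≤ f ((B ^ k) v)) :
    ∃ K : Set (ι → ℝ), IsProperCone K ∧ IsConeNonneg K B := by
  classical
  choose D hD using hub
  -- Bounds on the standard basis vectors add up to a bound uniform in `x`; the `+ 1` keeps `C`
  -- positive for later division.
  obtain ⟨C, hC, hCb⟩ : ∃ C, 0 < C ∧ ∀ x k, ‖(B ^ k) x‖ ≤ C * ‖x‖ * g k := by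
    refine ⟨∑ i, |D (Pi.single i 1)| + 1, by positivity, fun x k ↦ ?_⟩
    have hx : (B ^ k) x = ∑ i, x i • (B ^ k) (Pi.single i 1) := by
      conv_lhs => rw [pi_eq_sum_univ' x]
      simp [map_sum]
    calc ‖(B ^ k) x‖ ≤ ∑ i, ‖x i • (B ^ k) (Pi.single i 1)‖ := hx ▸ norm_sum_le _ _
      _ ≤ ∑ i, ‖x‖ * (|D (Pi.single i 1)| * g k) := by
          refine Finset.sum_le_sum fun i _ ↦ ?_
          rw [norm_smul]
          refine mul_le_mul (norm_le_pi_norm x i) ((hD _ k).trans ?_) (norm_nonneg _)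
            (norm_nonneg _)
          exact mul_le_mul_of_nonneg_right (le_abs_self _) (hg0 k)
      _ = (∑ i, |D (Pi.single i 1)|) * ‖x‖ * g k := by
          rw [Finset.sum_mul, Finset.sum_mul]
          exact Finset.sum_congr rfl fun i _ ↦ by ring
      _ ≤ (∑ i, |D (Pi.single i 1)| + 1) * ‖x‖ * g k := by
          have := hg0 k
          gcongr
          linarith
  let F : (ι → ℝ) →L[ℝ] ℝ := LinearMap.toContinuousLinearMap f
  have hF : ∀ x, |f x| ≤ (‖F‖ + 1) * ‖x‖ := fun x ↦ by
    have h1 := F.le_opNorm x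
    have h2 : ‖F x‖ = |f x| := rfl
    nlinarith [norm_nonneg x]
  set M := ‖F‖ + 1 with hM
  have hMpos : 0 < M := by positivity
  -- The lower bound `c * g k` is split in half: `δ` keeps the effect of perturbing `v` below one
  -- half, `e` keeps the norm term below the other.
  set δ : ℝ := min 1 (c / (2 * M * C)) with hδ
  have hδpos : 0 < δ := by positivity
  have hδM : M * C * δ ≤ c / 2 := by
    have : δ ≤ c / (2 * M * C) := min_le_right _ _
    rw [le_div_iff₀ (by positivity)] at this
    linarith
  set e : ℝ := c / (2 * C * (‖v‖ + 1)) with he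
  have hepos : 0 < e := by positivity
  have hmem : ∀ x, ‖x - v‖ < δ → ∀ k, e * ‖(B ^ k) x‖ ≤ f ((B ^ k) x) := by
    intro x hx k
    have h1 : f ((B ^ k) x) = f ((B ^ k) v) + f ((B ^ k) (x - v)) := by
      rw [← map_add, ← map_add]; congr 2; abel
    have h2 : |f ((B ^ k) (x - v))| ≤ c / 2 * g k := by
      calc |f ((B ^ k) (x - v))| ≤ M * ‖(B ^ k) (x - v)‖ := hF _
        _ ≤ M * (C * δ * g k) := by
            have := hg0 k
            refine mul_le_mul_of_nonneg_left ((hCb _ k).trans ?_) hMpos.le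
            gcongr
        _ = M * C * δ * g k := by ring
        _ ≤ c / 2 * g k := mul_le_mul_of_nonneg_right hδM (hg0 k)
    have h3 : e * ‖(B ^ k) x‖ ≤ c / 2 * g k := by
      have hxn : ‖x‖ ≤ ‖v‖ + 1 := by
        have h4 := norm_add_le (x - v) v
        rw [sub_add_cancel] at h4
        have h5 : δ ≤ 1 := min_le_left _ _
        linarith
      calc e * ‖(B ^ k) x‖ ≤ e * (C * (‖v‖ + 1) * g k) := by
            have := hg0 k
            refine mul_le_mul_of_nonneg_left ((hCb _ k).trans ?_) hepos.le
            gcongr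
        _ = c / 2 * g k := by rw [he]; field_simp
    have h4 := neg_abs_le (f ((B ^ k) (x - v)))
    have h5 := hlb k
    linarith
  have hcont : ∀ k, Continuous ⇑(B ^ k) := fun k ↦ LinearMap.continuous_of_finiteDimensional _
  -- Quantifying over all `k` makes invariance an index shift; `k = 0` alone gives pointedness, and
  -- the ball around `v` gives solidity.
  refine ⟨{x | ∀ k, e * ‖(B ^ k) x‖ ≤ f ((B ^ k) x)}, ⟨?_, ?_, ?_, ?_, ?_⟩, ?_⟩
  · simp only [Set.ofPred_forall]
    exact isClosed_iInter fun k ↦ isClosed_le (continuous_const.mul (hcont k).norm)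
      (F.continuous.comp (hcont k))
  · intro x hx y hy k
    have := mul_le_mul_of_nonneg_left (norm_add_le ((B ^ k) x) ((B ^ k) y)) hepos.le
    rw [map_add, map_add]
    linarith [hx k, hy k]
  · intro a ha x hx k
    have := mul_le_mul_of_nonneg_left (hx k) ha
    simp only [map_smul, norm_smul, Real.norm_of_nonneg ha, smul_eq_mul]
    linarith
  · refine Set.eq_singleton_iff_unique_mem.2 ⟨by simp, ?_⟩
    rintro x ⟨h1, h2⟩
    have h1 := h1 0
    have h2 := Set.mem_neg.1 h2 0
    simp only [pow_zero, End.one_apply, map_neg, norm_neg] at h1 h2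
    have : ‖x‖ ≤ 0 := by
      by_contra! h
      have := mul_pos hepos h
      linarith
    simpa using this
  · refine ⟨v, mem_interior.2 ⟨Metric.ball v δ, fun x hx ↦ ?_, Metric.isOpen_ball,
      Metric.mem_ball_self hδpos⟩⟩
    exact hmem x (by simpa [dist_eq_norm] using hx)
  · intro x hx k
    have := hx (k + 1)
    rwa [pow_succ] at this

/-! ### Growth of Jordan blocks -/

/-- The sum `∑ i < r, (k choose i) * ρ ^ (k - i)` (over `i ≤ k`), which is the growth rate in `k`
of the powers of a Jordan block of size `r` with eigenvalue `ρ`. -/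
def jordanGrowth (ρ : ℝ) : ℕ → ℕ → ℝ
  | 0, _ => 0
  | _ + 1, 0 => 1
  | r + 1, k + 1 => ρ * jordanGrowth ρ (r + 1) k + jordanGrowth ρ r k

@[simp] theorem jordanGrowth_zero (ρ : ℝ) (k : ℕ) : jordanGrowth ρ 0 k = 0 := by
  simp [jordanGrowth]

@[simp] theorem jordanGrowth_succ_zero (ρ : ℝ) (r : ℕ) : jordanGrowth ρ (r + 1) 0 = 1 := by
  simp [jordanGrowth]

theorem jordanGrowth_succ_succ (ρ : ℝ) (r k : ℕ) :
    jordanGrowth ρ (r + 1) (k + 1) = ρ * jordanGrowth ρ (r + 1) k + jordanGrowth ρ r k := by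
  simp [jordanGrowth]

theorem jordanGrowth_nonneg {ρ : ℝ} (hρ : 0 ≤ ρ) (r k : ℕ) : 0 ≤ jordanGrowth ρ r k := by
  induction k generalizing r with
  | zero => cases r <;> simp
  | succ k ih =>
    cases r with
    | zero => simp
    | succ r =>
      rw [jordanGrowth_succ_succ]
      have := ih r
      have := mul_nonneg hρ (ih (r + 1))
      linarith

theorem jordanGrowth_le_succ {ρ : ℝ} (hρ : 0 ≤ ρ) (r k : ℕ) :
    jordanGrowth ρ r k ≤ jordanGrowth ρ (r + 1) k := by
  induction k generalizing r with
  | zero => cases r <;> simp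
  | succ k ih =>
    cases r with
    | zero => simpa using jordanGrowth_nonneg hρ 1 (k + 1)
    | succ r =>
      rw [jordanGrowth_succ_succ, jordanGrowth_succ_succ]
      have := ih r
      have := mul_le_mul_of_nonneg_left (ih (r + 1)) hρ
      linarith

theorem jordanGrowth_mono {ρ : ℝ} (hρ : 0 ≤ ρ) (k : ℕ) :
    Monotone fun r ↦ jordanGrowth ρ r k :=
  monotone_nat_of_le_succ fun r ↦ jordanGrowth_le_succ hρ r k

section Growth

variable {V : Type*} [NormedAddCommGroup V] [NormedSpace ℝ V]

/-- The vectors whose orbits under `B` grow at most like `jordanGrowth ρ r`. -/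
def growthSubmodule (B : End ℝ V) (ρ : ℝ) (r : ℕ) : Submodule ℝ V where
  carrier := {x | ∃ C, ∀ k, ‖(B ^ k) x‖ ≤ C * jordanGrowth ρ r k}
  zero_mem' := ⟨0, fun k ↦ by simp⟩
  add_mem' := by
    rintro x y ⟨C, hC⟩ ⟨D, hD⟩
    refine ⟨C + D, fun k ↦ ?_⟩
    rw [map_add, add_mul]
    exact (norm_add_le _ _).trans (add_le_add (hC k) (hD k))
  smul_mem' := by
    rintro a x ⟨C, hC⟩
    refine ⟨|a| * C, fun k ↦ ?_⟩
    rw [map_smul, norm_smul, mul_assoc]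
    exact mul_le_mul_of_nonneg_left (hC k) (norm_nonneg _)

variable {B : End ℝ V} {ρ : ℝ} {r : ℕ} {μ : ℝ} {x : V}

theorem exists_bound_of_mem_growthSubmodule (hρ : 0 ≤ ρ) (h : x ∈ growthSubmodule B ρ r) :
    ∃ C, 0 ≤ C ∧ ∀ k, ‖(B ^ k) x‖ ≤ C * jordanGrowth ρ r k := by
  obtain ⟨C, hC⟩ := h
  refine ⟨|C|, abs_nonneg _, fun k ↦ (hC k).trans ?_⟩
  exact mul_le_mul_of_nonneg_right (le_abs_self C) (jordanGrowth_nonneg hρ r k)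

theorem growthSubmodule_mono {s : ℕ} (hρ : 0 ≤ ρ) (hrs : r ≤ s) :
    growthSubmodule B ρ r ≤ growthSubmodule B ρ s := by
  intro x hx
  obtain ⟨C, hC0, hC⟩ := exists_bound_of_mem_growthSubmodule hρ hx
  exact ⟨C, fun k ↦ (hC k).trans (mul_le_mul_of_nonneg_left (jordanGrowth_mono hρ k hrs) hC0)⟩

theorem norm_pow_succ_apply_le (B : End ℝ V) (μ : ℝ) (x : V) (k : ℕ) :
    ‖(B ^ (k + 1)) x‖ ≤ |μ| * ‖(B ^ k) x‖ + ‖(B ^ k) ((B - μ • 1) x)‖ := by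
  have : (B ^ (k + 1)) x = μ • (B ^ k) x + (B ^ k) ((B - μ • 1) x) := by
    simp [pow_succ]
  rw [this]
  refine (norm_add_le _ _).trans ?_
  rw [norm_smul, Real.norm_eq_abs]

theorem mem_growthSubmodule_succ (hμ : |μ| ≤ ρ)
    (h : (B - μ • 1) x ∈ growthSubmodule B ρ r) : x ∈ growthSubmodule B ρ (r + 1) := by
  have hρ : 0 ≤ ρ := (abs_nonneg μ).trans hμ
  obtain ⟨C, hC0, hC⟩ := exists_bound_of_mem_growthSubmodule hρ h
  refine ⟨max C ‖x‖, fun k ↦ ?_⟩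
  induction k with
  | zero => simp
  | succ k ih =>
    rw [jordanGrowth_succ_succ, mul_add]
    refine (norm_pow_succ_apply_le B μ x k).trans (add_le_add ?_ ((hC k).trans ?_))
    · calc |μ| * ‖(B ^ k) x‖ ≤ ρ * (max C ‖x‖ * jordanGrowth ρ (r + 1) k) := by gcongr
        _ = _ := by ring
    · exact mul_le_mul_of_nonneg_right (le_max_left _ _) (jordanGrowth_nonneg hρ r k)

/-- The strict gap between `|μ|` and `ρ` absorbs the chain term, so an eigenvalue below `ρ` never
raises the growth above `ρ ^ k`, however long its chains. -/
theorem mem_growthSubmodule_one (hμ : |μ| < ρ)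
    (h : (B - μ • 1) x ∈ growthSubmodule B ρ 1) : x ∈ growthSubmodule B ρ 1 := by
  have hρ : 0 ≤ ρ := (abs_nonneg μ).trans hμ.le
  obtain ⟨C, hC0, hC⟩ := exists_bound_of_mem_growthSubmodule hρ h
  -- `D` satisfies `|μ| * D + C ≤ ρ * D`, which is what the induction step needs; `‖x‖` covers `k =
  -- 0`.
  set D := max (C / (ρ - |μ|)) ‖x‖ with hD
  have hD' : C ≤ D * (ρ - |μ|) := by
    rw [← div_le_iff₀ (by linarith)]
    exact le_max_left _ _
  refine ⟨D, fun k ↦ ?_⟩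
  induction k with
  | zero => simp [hD]
  | succ k ih =>
    have hg := jordanGrowth_nonneg hρ 1 k
    have h1 := mul_le_mul_of_nonneg_left ih (abs_nonneg μ)
    have h2 := mul_le_mul_of_nonneg_right hD' hg
    have h3 : jordanGrowth ρ 1 (k + 1) = ρ * jordanGrowth ρ 1 k := by
      simpa using jordanGrowth_succ_succ ρ 0 k
    rw [h3]
    refine (norm_pow_succ_apply_le B μ x k).trans ?_
    linarith [hC k]

theorem mem_growthSubmodule_of_pow_eq_zero (hμ : |μ| ≤ ρ) {d : ℕ} {x : V}
    (h : ((B - μ • 1) ^ d) x = 0) : x ∈ growthSubmodule B ρ d := by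
  induction d generalizing x with
  | zero =>
    have : x = 0 := by simpa using h
    exact this ▸ zero_mem _
  | succ d ih =>
    refine mem_growthSubmodule_succ hμ (ih ?_)
    rwa [pow_succ] at h

theorem mem_growthSubmodule_one_of_pow_eq_zero (hμ : |μ| < ρ) {d : ℕ} {x : V}
    (h : ((B - μ • 1) ^ d) x = 0) : x ∈ growthSubmodule B ρ 1 := by
  induction d generalizing x with
  | zero =>
    have : x = 0 := by simpa using h
    exact this ▸ zero_mem _
  | succ d ih =>
    refine mem_growthSubmodule_one hμ (ih ?_)
    rwa [pow_succ] at h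

end Growth

/-! ### Jordan chains -/

/-- A Jordan chain lies in the open half space of some functional. -/
theorem exists_dual_pos_on_chain {V : Type*} [AddCommGroup V] [Module ℝ V] (N : End ℝ V)
    (d : ℕ) (v : V) (h : (N ^ (d + 1)) v = 0) (h' : (N ^ d) v ≠ 0) :
    ∃ f : V →ₗ[ℝ] ℝ, ∀ i ≤ d, 0 < f ((N ^ i) v) := by
  induction d generalizing v with
  | zero =>
    obtain ⟨f, hf⟩ : ∃ f : Module.Dual ℝ V, f v ≠ 0 := by
      by_contra! hc
      exact h' (by simpa using (Module.forall_dual_apply_eq_zero_iff ℝ v).1 hc)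
    refine ⟨f v • f, fun i hi ↦ ?_⟩
    obtain rfl : i = 0 := by lia
    simpa using mul_self_pos.2 hf
  | succ d ih =>
    obtain ⟨f, hf⟩ := ih (N v) (by rwa [pow_succ] at h) (by rwa [pow_succ] at h')
    have h0 : 0 < f (N v) := by simpa using hf 0 (Nat.zero_le _)
    have hf' : ∀ i, f (N ((N ^ i) v)) = f ((N ^ i) (N v)) := fun i ↦ by
      rw [← Module.End.mul_apply, ← pow_succ', pow_succ, Module.End.mul_apply]
    -- Adding `t • f ∘ N` outweighs a possibly negative `f v`, and does no harm further down the
    -- chain, where `f ∘ N` is nonnegative and vanishes at the last vector.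
    set t := (|f v| + 1) / f (N v) with ht
    have htpos : 0 < t := by positivity
    refine ⟨f + t • f ∘ₗ N, fun i hi ↦ ?_⟩
    rcases i with _ | i
    · have h1 : t * f (N v) = |f v| + 1 := by rw [ht]; field_simp
      have h2 := neg_abs_le (f v)
      simp only [pow_zero, End.one_apply, LinearMap.add_apply, LinearMap.smul_apply,
        LinearMap.comp_apply, smul_eq_mul, h1]
      linarith
    · have h1 : 0 < f ((N ^ (i + 1)) v) := by
        rw [pow_succ, Module.End.mul_apply]
        exact hf i (by lia)
      have h2 : 0 ≤ f (N ((N ^ (i + 1)) v)) := by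
        rw [hf']
        rcases Nat.lt_or_ge i d with hid | hid
        · exact (hf (i + 1) hid).le
        · obtain rfl : i = d := by lia
          have : (N ^ (i + 1)) (N v) = 0 := by rwa [pow_succ] at h
          simp [this]
      simp only [LinearMap.add_apply, LinearMap.smul_apply, LinearMap.comp_apply, smul_eq_mul]
      have := mul_nonneg htpos.le h2
      linarith

/-- With `N = B - ρ • 1`, the identity `B ^ (k + 1) v = ρ • B ^ k v + B ^ k (N v)` mirrors the
recursion of `jordanGrowth`, as `N v` heads a chain one shorter. -/
theorem jordanGrowth_le_apply {V : Type*} [AddCommGroup V] [Module ℝ V] (B : End ℝ V) {ρ : ℝ}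
    (hρ : 0 ≤ ρ) (f : V →ₗ[ℝ] ℝ) (c : ℝ) (d : ℕ) (v : V)
    (h : ((B - ρ • 1) ^ d) v = 0) (hf : ∀ i < d, c ≤ f (((B - ρ • 1) ^ i) v)) (k : ℕ) :
    c * jordanGrowth ρ d k ≤ f ((B ^ k) v) := by
  induction k generalizing d v with
  | zero =>
    rcases d with _ | d
    · have : v = 0 := by simpa using h
      simp [this]
    · simpa using hf 0 (by lia)
  | succ k ih =>
    rcases d with _ | d
    · have : v = 0 := by simpa using h
      simp [this]
    · have h1 := ih (d + 1) v h hf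
      have h2 := ih d ((B - ρ • 1) v) (by rwa [pow_succ] at h) fun i hi ↦ by
        have := hf (i + 1) (by lia)
        rwa [pow_succ] at this
      have h3 : (B ^ (k + 1)) v = ρ • (B ^ k) v + (B ^ k) ((B - ρ • 1) v) := by
        simp [pow_succ]
      rw [h3, map_add, map_smul, smul_eq_mul, jordanGrowth_succ_succ]
      have := mul_le_mul_of_nonneg_left h1 hρ
      linarith

theorem IsConeNonneg.preimage {V W : Type*} [AddCommGroup V] [Module ℝ V] [AddCommGroup W]
    [Module ℝ W] (φ : V ≃ₗ[ℝ] W) {K : Set W} {B : End ℝ V} (h : IsConeNonneg K (φ.conj B)) :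
    IsConeNonneg (φ ⁻¹' K) B := fun x hx ↦ by
  simpa [LinearEquiv.conj_apply] using h (φ x) hx

/-- Among all Jordan chains of `B` there is one that is maximal with respect to the absolute value
of the eigenvalue first and to the length second. -/
theorem exists_dominant_chain {V : Type*} [AddCommGroup V] [Module ℝ V] [FiniteDimensional ℝ V]
    [Nontrivial V] (B : End ℝ V) (hB : ⨆ μ, B.maxGenEigenspace μ = ⊤) :
    ∃ (μ : ℝ) (d : ℕ) (v : V), ((B - μ • 1) ^ (d + 1)) v = 0 ∧ ((B - μ • 1) ^ d) v ≠ 0 ∧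
      ∀ (ν : ℝ) (e : ℕ) (w : V), ((B - ν • 1) ^ (e + 1)) w = 0 → ((B - ν • 1) ^ e) w ≠ 0 →
        |ν| < |μ| ∨ |ν| = |μ| ∧ e ≤ d := by
  let P : Set (ℝ × ℕ) := {p | ∃ w : V, ((B - p.1 • 1) ^ (p.2 + 1)) w = 0 ∧
    ((B - p.1 • 1) ^ p.2) w ≠ 0}
  -- There are finitely many eigenvalues, and chain lengths are bounded since generalized
  -- eigenspaces stabilize at exponent `finrank ℝ V`.
  have hfin : P.Finite := by
    refine ((B.finite_hasEigenvalue).prod (Set.finite_Iic (finrank ℝ V))).subset ?_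
    rintro ⟨ν, e⟩ ⟨w, hw, hw'⟩
    refine ⟨?_, ?_⟩
    · refine End.hasEigenvalue_of_hasEigenvector (x := ((B - ν • 1) ^ e) w) ⟨?_, hw'⟩
      rw [End.mem_eigenspace_iff]
      rw [pow_succ'] at hw
      simpa [sub_eq_zero] using hw
    · by_contra! h
      have h1 : w ∈ B.genEigenspace ν (e + 1 : ℕ) := by
        rw [End.mem_genEigenspace_nat]
        exact hw
      have h2 := End.genEigenspace_le_genEigenspace_finrank B ν _ h1
      have h3 : w ∈ B.genEigenspace ν (e : ℕ) :=
        (B.genEigenspace ν).mono (by simpa using (Set.notMem_Iic.1 h).le) h2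
      rw [End.mem_genEigenspace_nat] at h3
      exact hw' h3
  have hne : P.Nonempty := by
    obtain ⟨μ, hμ⟩ := End.exists_hasEigenvalue_of_genEigenspace_eq_top ⊤ hB
    obtain ⟨w, hw⟩ := hμ.exists_hasEigenvector
    refine ⟨(μ, 0), w, ?_, by simpa using hw.2⟩
    simp [hw.apply_eq_smul]
  obtain ⟨⟨μ, d⟩, ⟨v, hv, hv'⟩, hmax⟩ :=
    Set.exists_max_image P (fun p ↦ toLex (|p.1|, p.2)) hfin hne
  refine ⟨μ, d, v, hv, hv', fun ν e w hw hw' ↦ ?_⟩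
  have := hmax (ν, e) ⟨w, hw, hw'⟩
  rwa [Prod.Lex.toLex_le_toLex] at this

/-! ### Signed invariant cones -/

theorem exists_signed_invariant_cone_pi {ι : Type*} [Fintype ι] (B : End ℝ (ι → ℝ))
    (hB : ⨆ μ, B.maxGenEigenspace μ = ⊤) :
    ∃ (ε : ℝ) (K : Set (ι → ℝ)), (ε = 1 ∨ ε = -1) ∧ IsProperCone K ∧
      IsConeNonneg K (ε • B) := by
  rcases subsingleton_or_nontrivial (ι → ℝ) with hs | hs
  · refine ⟨1, Set.univ, Or.inl rfl, ⟨isClosed_univ, by simp, by simp, ?_, by simp⟩,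
      fun _ _ ↦ trivial⟩
    exact Set.eq_singleton_iff_unique_mem.2 ⟨by simp, fun x _ ↦ Subsingleton.elim _ _⟩
  obtain ⟨μ, d, v, hv, hv', hmax⟩ := exists_dominant_chain B hB
  obtain ⟨ε, hε, hεμ⟩ : ∃ ε : ℝ, (ε = 1 ∨ ε = -1) ∧ |μ| = ε * μ := by
    rcases abs_choice μ with h | h
    · exact ⟨1, Or.inl rfl, by simpa using h⟩
    · exact ⟨-1, Or.inr rfl, by simpa using h⟩
  have hε1 : |ε| = 1 := by rcases hε with rfl | rfl <;> simp
  have hε0 : ε ≠ 0 := by rintro rfl; simp at hε1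
  have hgrow : ∀ x, x ∈ growthSubmodule B |μ| (d + 1) := by
    intro x
    have hx : x ∈ ⨆ ν, B.maxGenEigenspace ν := hB ▸ Submodule.mem_top
    refine Submodule.iSup_induction _ (motive := (· ∈ growthSubmodule B |μ| (d + 1))) hx ?_
      (zero_mem _) fun _ _ ↦ add_mem
    intro ν y hy
    rw [End.mem_maxGenEigenspace] at hy
    classical
    -- The least annihilating exponent makes `y` the top of a genuine chain, to which the maximality
    -- `hmax` applies.
    rcases h : Nat.find hy with _ | e
    · have := Nat.find_spec hy
      rw [h] at this
      have : y = 0 := by simpa using this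
      exact this ▸ zero_mem _
    · have h1 := Nat.find_spec hy
      have h2 := Nat.find_min hy (m := e) (by lia)
      rw [h] at h1
      rcases hmax ν e y h1 h2 with h3 | ⟨h3, h4⟩
      · exact growthSubmodule_mono (abs_nonneg μ) (by lia)
          (mem_growthSubmodule_one_of_pow_eq_zero h3 h1)
      · exact growthSubmodule_mono (abs_nonneg μ) (by lia)
          (mem_growthSubmodule_of_pow_eq_zero h3.le h1)
  have hN : ∀ i, ((ε • B - |μ| • 1) ^ i : End ℝ (ι → ℝ)) = ε ^ i • (B - μ • 1) ^ i := fun i ↦ by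
    rw [← smul_pow, smul_sub, smul_smul, hεμ]
  obtain ⟨f, hf⟩ := exists_dual_pos_on_chain (ε • B - |μ| • 1) d v (by simp [hN, hv])
    (by simpa [hN, hε0] using hv')
  obtain ⟨c, hc, hcf⟩ : ∃ c, 0 < c ∧ ∀ i < d + 1, c ≤ f (((ε • B - |μ| • 1) ^ i) v) := by
    obtain ⟨j, hj, hjmin⟩ := Finset.exists_min_image (Finset.range (d + 1))
      (fun i ↦ f (((ε • B - |μ| • 1) ^ i) v)) ⟨0, by simp⟩
    exact ⟨_, hf j (by simpa [Nat.lt_succ_iff] using hj), fun i hi ↦ hjmin i (by simpa using hi)⟩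
  obtain ⟨K, hK, hKB⟩ := exists_isProperCone_of_orbit_bound (ε • B) (jordanGrowth |μ| (d + 1))
    (jordanGrowth_nonneg (abs_nonneg μ) _)
    (fun x ↦ by
      obtain ⟨C, hC⟩ := hgrow x
      refine ⟨C, fun k ↦ ?_⟩
      rw [smul_pow, LinearMap.smul_apply, norm_smul, norm_pow, Real.norm_eq_abs, hε1, one_pow,
        one_mul]
      exact hC k)
    f v c hc
    (jordanGrowth_le_apply (ε • B) (abs_nonneg μ) f c (d + 1) v (by simp [hN, hv]) hcf)
  exact ⟨ε, K, hε, hK, hKB⟩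

/-- An operator whose generalized eigenspaces span leaves, up to a sign, a proper cone
invariant. -/
theorem exists_signed_invariant_cone {V : Type*} [AddCommGroup V] [Module ℝ V]
    [FiniteDimensional ℝ V] [TopologicalSpace V] [IsModuleTopology ℝ V] (B : End ℝ V)
    (hB : ⨆ μ, B.maxGenEigenspace μ = ⊤) :
    ∃ (ε : ℝ) (K : Set V), (ε = 1 ∨ ε = -1) ∧ IsProperCone K ∧ IsConeNonneg K (ε • B) := by
  let φ : V ≃ₗ[ℝ] (Fin (finrank ℝ V) → ℝ) := (finBasis ℝ V).equivFun
  obtain ⟨ε, K, hε, hK, hKB⟩ := exists_signed_invariant_cone_pi (φ.conj B) (by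
    rw [eq_top_iff]
    intro y _
    have hx : φ.symm y ∈ ⨆ ν, B.maxGenEigenspace ν := hB ▸ Submodule.mem_top
    have : φ (φ.symm y) ∈ ⨆ μ, (φ.conj B).maxGenEigenspace μ := by
      refine Submodule.iSup_induction _
        (motive := fun x ↦ φ x ∈ ⨆ μ, (φ.conj B).maxGenEigenspace μ) hx ?_ (by simp) ?_
      · intro ν x hx
        refine Submodule.mem_iSup_of_mem ν ?_
        rw [End.mem_maxGenEigenspace] at hx ⊢
        obtain ⟨k, hk⟩ := hx
        refine ⟨k, ?_⟩
        have h1 : φ.conj B - ν • 1 = φ.conj (B - ν • 1) := by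
          rw [map_sub, map_smul]; congr 2; exact (φ.conj_id).symm
        have h2 : ∀ (C : End ℝ V) (k : ℕ) (z : V), ((φ.conj C) ^ k) (φ z) = φ ((C ^ k) z) := by
          intro C k z
          induction k generalizing z with
          | zero => simp
          | succ k ih =>
            rw [pow_succ, pow_succ, End.mul_apply, End.mul_apply, ← ih]
            simp [LinearEquiv.conj_apply_apply]
        rw [h1, h2, hk, map_zero]
      · intro x y hx hy
        rw [map_add]
        exact add_mem hx hy
    simpa using this)
  refine ⟨ε, φ ⁻¹' K, hε, hK.preimage φ, IsConeNonneg.preimage φ ?_⟩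
  rwa [map_smul]

/-! ### Generalized eigenspaces of exterior powers and split operators -/

/-- Exterior products of generalized eigenvectors are generalized eigenvectors. -/
theorem pow_map_sub_apply_ιMulti_eq_zero {R M : Type*} [CommRing R] [AddCommGroup M] [Module R M]
    {j : ℕ} (A : End R M) (μ : Fin j → R) (N : ℕ) (d : Fin j → ℕ) (x : Fin j → M)
    (hx : ∀ i, ((A - μ i • 1) ^ d i) (x i) = 0) (hd : ∑ i, d i < N) :
    ((exteriorPower.map j A - (∏ i, μ i) • 1 : End R (⋀[R]^j M)) ^ N)
      (exteriorPower.ιMulti R j x) = 0 := by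
  classical
  induction N generalizing d x with
  | zero => lia
  | succ N ih =>
    by_cases h0 : ∃ i, d i = 0
    · obtain ⟨i, hi⟩ := h0
      have : x i = 0 := by simpa [hi] using hx i
      rw [(exteriorPower.ιMulti R j).map_coord_zero i this, map_zero]
    push Not at h0
    -- Expand `A (x i) = μ i • x i + (A - μ i • 1) (x i)` multilinearly. Subtracting the product of
    -- eigenvalues removes the term `s = univ`; every other term has a smaller total exponent.
    have hstep : (exteriorPower.map j A - (∏ i, μ i) • 1 : End R (⋀[R]^j M))
        (exteriorPower.ιMulti R j x) = ∑ s ∈ Finset.univ.erase Finset.univ,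
          exteriorPower.ιMulti R j
            (s.piecewise (fun i ↦ μ i • x i) fun i ↦ (A - μ i • 1) (x i)) := by
      have h1 : (A ∘ x : Fin j → M) = (fun i ↦ μ i • x i) + fun i ↦ (A - μ i • 1) (x i) := by
        ext i
        simp
      have h2 := (exteriorPower.ιMulti R j (M := M)).toMultilinearMap.map_add_univ
        (fun i ↦ μ i • x i) fun i ↦ (A - μ i • 1) (x i)
      rw [← h1, ← Finset.add_sum_erase _ _ (Finset.mem_univ Finset.univ), Finset.piecewise_univ,
        MultilinearMap.map_smul_univ] at h2
      rw [LinearMap.sub_apply, exteriorPower.map_apply_ιMulti]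
      simpa [sub_eq_iff_eq_add'] using h2
    rw [pow_succ, End.mul_apply, hstep, map_sum]
    refine Finset.sum_eq_zero fun s hs ↦ ?_
    refine ih (s.piecewise d fun i ↦ d i - 1) _ (fun i ↦ ?_) ?_
    · by_cases his : i ∈ s
      · simp [his, hx i]
      · obtain ⟨e, he⟩ := Nat.exists_eq_succ_of_ne_zero (h0 i)
        have := hx i
        rw [he, pow_succ, End.mul_apply] at this
        simpa only [Finset.piecewise_eq_of_notMem _ _ _ his, he, Nat.succ_sub_one] using this
    · have hs' : ∃ i, i ∉ s := by
        by_contra! h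
        exact (Finset.mem_erase.1 hs).1 (Finset.eq_univ_iff_forall.2 h)
      obtain ⟨i, hi⟩ := hs'
      have : ∑ i, s.piecewise d (fun i ↦ d i - 1) i < ∑ i, d i := by
        refine Finset.sum_lt_sum (fun k _ ↦ ?_) ⟨i, Finset.mem_univ _, ?_⟩
        · by_cases hk : k ∈ s <;> simp [hk]
        · have := h0 i
          simp only [Finset.piecewise_eq_of_notMem _ _ _ hi]
          lia
      lia

theorem iSup_maxGenEigenspace_exteriorPower_map {R M : Type*} [CommRing R] [AddCommGroup M]
    [Module R M] (j : ℕ) (A : End R M) (hA : ⨆ μ, A.maxGenEigenspace μ = ⊤) :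
    ⨆ μ, End.maxGenEigenspace (exteriorPower.map j A : End R (⋀[R]^j M)) μ = ⊤ := by
  rw [Submodule.iSup_eq_span] at hA
  rw [eq_top_iff, ← exteriorPower.ιMulti_span_of_span R j M hA, Submodule.span_le]
  rintro _ ⟨x, hx, rfl⟩
  have : ∀ i, ∃ (μ : R) (d : ℕ), ((A - μ • 1) ^ d) (x i) = 0 := fun i ↦ by
    simpa only [Set.mem_iUnion, SetLike.mem_coe, End.mem_maxGenEigenspace] using
      hx (Set.mem_range_self i)
  choose μ d h using this
  exact Submodule.mem_iSup_of_mem (∏ i, μ i) ((End.mem_maxGenEigenspace _ _ _).2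
    ⟨_, pow_map_sub_apply_ιMulti_eq_zero A μ _ d x h (Nat.lt_succ_self _)⟩)

-- Split off one root at a time: `(X - r) ^ m` with full multiplicity `m` is coprime to the
-- cofactor, so the kernel is the sum of the two kernels.
open Polynomial in
theorem ker_aeval_le_iSup_maxGenEigenspace {K V : Type*} [Field K] [AddCommGroup V] [Module K V]
    (f : End K V) (p : K[X]) (hp : p ≠ 0) (hs : p.Splits) :
    LinearMap.ker (aeval f p) ≤ ⨆ μ, f.maxGenEigenspace μ := by
  induction h : p.natDegree using Nat.strong_induction_on generalizing p with
  | h n ih =>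
    by_cases hdeg : p.degree = 0
    · rw [Polynomial.eq_C_of_degree_eq_zero hdeg] at hp ⊢
      have hc : p.coeff 0 ≠ 0 := by simpa using hp
      intro x hx
      have : x = 0 := by simpa [hc] using hx
      exact this ▸ zero_mem _
    · obtain ⟨r, hr⟩ := hs.exists_eval_eq_zero hdeg
      obtain ⟨q, hq, hrq⟩ := exists_eq_pow_rootMultiplicity_mul_and_not_dvd p hp r
      have hm : 0 < p.rootMultiplicity r := (rootMultiplicity_pos hp).2 hr
      have hq0 : q ≠ 0 := by rintro rfl; simp at hrq
      have hcop : IsCoprime ((X - C r) ^ p.rootMultiplicity r) q :=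
        ((irreducible_X_sub_C r).coprime_iff_not_dvd.2 hrq).pow_left
      have hdvd : q ∣ p := ⟨_, hq.trans (mul_comm _ _)⟩
      have hlt : q.natDegree < n := by
        have : p.natDegree = p.rootMultiplicity r + q.natDegree := by
          conv_lhs => rw [hq]
          rw [natDegree_mul (pow_ne_zero _ (X_sub_C_ne_zero r)) hq0, natDegree_pow,
            natDegree_X_sub_C, mul_one]
        lia
      rw [hq, ← sup_ker_aeval_eq_ker_aeval_mul_of_coprime f hcop]
      refine sup_le (fun x hx ↦ Submodule.mem_iSup_of_mem r ?_)
        (ih _ hlt q hq0 (hs.of_dvd hp hdvd) rfl)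
      rw [End.mem_maxGenEigenspace]
      refine ⟨p.rootMultiplicity r, ?_⟩
      simpa [Algebra.algebraMap_eq_smul_one] using hx

theorem iSup_maxGenEigenspace_eq_top_of_splits {K V : Type*} [Field K] [AddCommGroup V]
    [Module K V] [FiniteDimensional K V] (f : End K V) (hf : f.charpoly.Splits) :
    ⨆ μ, f.maxGenEigenspace μ = ⊤ := by
  have := ker_aeval_le_iSup_maxGenEigenspace f f.charpoly (LinearMap.charpoly_monic f).ne_zero hf
  rwa [LinearMap.aeval_self_charpoly, LinearMap.ker_zero, top_le_iff] at this

theorem charpoly_splits_of_isEigenvalue_im_eq_zero {n : ℕ}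
    (A : EuclideanSpace ℝ (Fin n) →ₗ[ℝ] EuclideanSpace ℝ (Fin n))
    (hreal : ∀ μ : ℂ, IsEigenvalue A μ → μ.im = 0) : A.charpoly.Splits := by
  refine Polynomial.Splits.of_splits_map (algebraMap ℝ ℂ) (IsAlgClosed.splits _) fun μ hμ ↦ ?_
  refine ⟨μ.re, ?_⟩
  have hr := Polynomial.isRoot_of_mem_roots hμ
  rw [← LinearMap.charpoly_baseChange, ← End.hasEigenvalue_iff_isRoot_charpoly] at hr
  apply Complex.ext <;> simp [hreal μ hr]

/-! ### Strict positivity for a dominant eigenvalue -/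

theorem isProperCone_sum_abs_le {ι : Type*} [Fintype ι] [DecidableEq ι] (i₀ : ι) :
    IsProperCone {x : ι → ℝ | ∑ i ∈ Finset.univ.erase i₀, |x i| ≤ x i₀} := by
  have hcont : Continuous fun x : ι → ℝ ↦ ∑ i ∈ Finset.univ.erase i₀, |x i| := by fun_prop
  refine ⟨isClosed_le hcont (by fun_prop), fun x hx y hy ↦ ?_, fun a ha x hx ↦ ?_, ?_, ?_⟩
  · rw [Set.mem_ofPred_eq] at hx hy ⊢
    refine le_trans ?_ (add_le_add hx hy)
    rw [← Finset.sum_add_distrib]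
    exact Finset.sum_le_sum fun i _ ↦ abs_add_le _ _
  · have := mul_le_mul_of_nonneg_left (Set.mem_ofPred_eq ▸ hx) ha
    rw [Finset.mul_sum] at this
    simpa only [Set.mem_ofPred_eq, Pi.smul_apply, smul_eq_mul, abs_mul, abs_of_nonneg ha] using this
  · refine Set.eq_singleton_iff_unique_mem.2 ⟨by simp, ?_⟩
    rintro x ⟨h1, h2⟩
    have h1 : ∑ i ∈ Finset.univ.erase i₀, |x i| ≤ x i₀ := h1
    have h2 : ∑ i ∈ Finset.univ.erase i₀, |x i| ≤ -x i₀ := by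
      have : ∑ i ∈ Finset.univ.erase i₀, |(-x) i| ≤ (-x) i₀ := h2
      simpa using this
    have h0 : 0 ≤ ∑ i ∈ Finset.univ.erase i₀, |x i| := Finset.sum_nonneg fun _ _ ↦ abs_nonneg _
    have hs : ∑ i ∈ Finset.univ.erase i₀, |x i| = 0 := by linarith
    rw [Finset.sum_eq_zero_iff_of_nonneg fun _ _ ↦ abs_nonneg _] at hs
    ext i
    by_cases hi : i = i₀
    · subst hi
      simp only [Pi.zero_apply]
      linarith
    · simpa using hs i (by simp [hi])
  · refine ⟨Pi.single i₀ 1, mem_interior.2 ⟨{x | ∑ i ∈ Finset.univ.erase i₀, |x i| < x i₀},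
      fun x hx ↦ LT.lt.le (Set.mem_ofPred_eq ▸ hx), isOpen_lt hcont (by fun_prop), ?_⟩⟩
    have : ∑ i ∈ Finset.univ.erase i₀, |(Pi.single i₀ 1 : ι → ℝ) i| = 0 :=
      Finset.sum_eq_zero fun i hi ↦ by simp [(Finset.mem_erase.1 hi).1]
    rw [Set.mem_ofPred_eq, this]
    simp

/-- A diagonalizable operator with a strictly dominant nonzero eigenvalue is, up to a sign,
positive with respect to some proper cone. -/
theorem exists_signed_positive_cone {V ι : Type*} [AddCommGroup V] [Module ℝ V]
    [TopologicalSpace V] [IsModuleTopology ℝ V] [Finite ι] (b : Basis ι ℝ V) (B : End ℝ V)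
    (l : ι → ℝ) (hB : ∀ i, B (b i) = l i • b i) (i₀ : ι) (h0 : l i₀ ≠ 0)
    (hl : ∀ i ≠ i₀, |l i| < |l i₀|) :
    ∃ (ε : ℝ) (K : Set V), (ε = 1 ∨ ε = -1) ∧ IsProperCone K ∧ IsConePos K (ε • B) := by
  classical
  have := Fintype.ofFinite ι
  obtain ⟨ε, hε, hεl⟩ : ∃ ε : ℝ, (ε = 1 ∨ ε = -1) ∧ |l i₀| = ε * l i₀ := by
    rcases abs_choice (l i₀) with h | h
    · exact ⟨1, Or.inl rfl, by simpa using h⟩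
    · exact ⟨-1, Or.inr rfl, by simpa using h⟩
  have hε1 : |ε| = 1 := by rcases hε with rfl | rfl <;> simp
  have hcoord : ∀ x i, b.equivFun ((ε • B) x) i = ε * (l i * b.equivFun x i) := by
    intro x i
    have : b.coord i ∘ₗ B = l i • b.coord i := by
      refine b.ext fun k ↦ ?_
      by_cases hk : k = i
      · subst hk; simp [hB]
      · simp [hB, hk]
    have := LinearMap.congr_fun this x
    simp only [LinearMap.comp_apply, Basis.coord_apply, LinearMap.smul_apply, smul_eq_mul] at this
    simp [this]
  refine ⟨ε, b.equivFun ⁻¹' {x : ι → ℝ | ∑ i ∈ Finset.univ.erase i₀, |x i| ≤ x i₀}, hε,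
    (isProperCone_sum_abs_le i₀).preimage b.equivFun, ?_⟩
  rintro x ⟨hx, hx0⟩
  apply interior_preimage_linearEquiv
  refine mem_interior.2 ⟨{x | ∑ i ∈ Finset.univ.erase i₀, |x i| < x i₀},
    fun x hx ↦ LT.lt.le (Set.mem_ofPred_eq ▸ hx), isOpen_lt (by fun_prop) (by fun_prop), ?_⟩
  have hx : ∑ i ∈ Finset.univ.erase i₀, |b.equivFun x i| ≤ b.equivFun x i₀ := hx
  have hx0 : b.equivFun x ≠ 0 := fun h ↦ hx0 (by simpa using h)
  change ∑ i ∈ Finset.univ.erase i₀, |b.equivFun ((ε • B) x) i| < b.equivFun ((ε • B) x) i₀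
  simp only [hcoord]
  generalize b.equivFun x = y at hx hx0
  simp only [abs_mul, hε1, one_mul]
  rw [← mul_assoc, ← hεl]
  have hpos : 0 < |l i₀| := abs_pos.2 h0
  -- Strictness comes from `|l k| < |l i₀|` at a nonzero coordinate `k ≠ i₀`; with no such
  -- coordinate, it comes from `y i₀ > 0`.
  by_cases hy : ∀ i ≠ i₀, y i = 0
  · rw [Finset.sum_eq_zero fun i hi ↦ by simp [hy i (Finset.mem_erase.1 hi).1]]
    refine mul_pos hpos (lt_of_le_of_ne ?_ fun h ↦ hx0 ?_)
    · exact le_trans (Finset.sum_nonneg fun _ _ ↦ abs_nonneg _) hx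
    · ext i
      by_cases hi : i = i₀
      · exact hi ▸ h.symm
      · exact hy i hi
  · push Not at hy
    obtain ⟨k, hk, hyk⟩ := hy
    calc ∑ i ∈ Finset.univ.erase i₀, |l i| * |y i|
        < ∑ i ∈ Finset.univ.erase i₀, |l i₀| * |y i| := by
          refine Finset.sum_lt_sum (fun i hi ↦ ?_) ⟨k, by simp [hk], ?_⟩
          · exact mul_le_mul_of_nonneg_right (hl i (Finset.mem_erase.1 hi).1).le (abs_nonneg _)
          · exact mul_lt_mul_of_pos_right (hl k hk) (abs_pos.2 hyk)
      _ = |l i₀| * ∑ i ∈ Finset.univ.erase i₀, |y i| := (Finset.mul_sum _ _ _).symm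
      _ ≤ _ := mul_le_mul_of_nonneg_left hx hpos.le

/-- Makes the initial segment termwise minimal among `j`-element index sets, so that its eigenvalue
product is the largest in absolute value. -/
theorem Fin.val_le_apply_of_strictMono {j n : ℕ} {e : Fin j → Fin n} (he : StrictMono e)
    (i : Fin j) : (i : ℕ) ≤ e i := by
  obtain ⟨i, hi⟩ := i
  induction i with
  | zero => simp
  | succ i ih =>
    have h1 := ih (by lia)
    have h2 : e ⟨i, by lia⟩ < e ⟨i + 1, hi⟩ := he (by simp)
    have h3 := Fin.lt_def.1 h2
    simp only at h1 ⊢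
    lia

/-- If `A` is diagonal in the basis `b`, with nonzero eigenvalues ordered by strictly decreasing
absolute value, then each `⋀ʲ A` is, up to a sign, positive with respect to some proper cone. -/
theorem exists_signed_positive_cone_exteriorPower {M : Type*} [AddCommGroup M] [Module ℝ M]
    {n j : ℕ} (hj : j ≤ n) [TopologicalSpace (⋀[ℝ]^j M)] [IsModuleTopology ℝ (⋀[ℝ]^j M)]
    (b : Basis (Fin n) ℝ M) (A : End ℝ M) (l : Fin n → ℝ) (hA : ∀ i, A (b i) = l i • b i)
    (h0 : ∀ i, l i ≠ 0) (hl : StrictAnti fun i ↦ |l i|) :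
    ∃ (ε : ℝ) (K : Set (⋀[ℝ]^j M)), (ε = 1 ∨ ε = -1) ∧ IsProperCone K ∧
      IsConePos K (ε • exteriorPower.map j A) := by
  let E : Fin j ↪o Fin n ≃ Set.powersetCard (Fin n) j := Set.powersetCard.ofFinEmbEquiv
  refine exists_signed_positive_cone (b.exteriorPower j) (exteriorPower.map j A)
    (fun s ↦ ∏ i, l (E.symm s i)) (fun s ↦ ?_) (E (Fin.castLEOrderEmb hj))
    (Finset.prod_ne_zero_iff.2 fun i _ ↦ h0 _) fun s hs ↦ ?_
  · rw [exteriorPower.basis_apply, exteriorPower.map_apply_ιMulti_family]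
    have h1 : A ∘ b = fun i ↦ l i • b i := funext hA
    rw [h1]
    exact (exteriorPower.ιMulti ℝ j (M := M)).toMultilinearMap.map_smul_univ
      (fun i ↦ l (E.symm s i)) fun i ↦ b (E.symm s i)
  · simp only [Finset.abs_prod, Equiv.symm_apply_apply]
    have hle : ∀ i, Fin.castLEOrderEmb hj i ≤ E.symm s i := fun i ↦
      Fin.le_def.2 (Fin.val_le_apply_of_strictMono (E.symm s).strictMono i)
    obtain ⟨i, hi⟩ : ∃ i, Fin.castLEOrderEmb hj i ≠ E.symm s i := by
      by_contra! h
      have : Fin.castLEOrderEmb hj = E.symm s := by ext i; exact congrArg Fin.val (h i)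
      exact hs (by rw [this, Equiv.apply_symm_apply])
    exact Finset.prod_lt_prod (fun i _ ↦ abs_pos.2 (h0 _)) (fun i _ ↦ hl.antitone (hle i))
      ⟨i, Finset.mem_univ _, hl (lt_of_le_of_ne (hle i) hi)⟩

/-- An operator with `n = dim M` eigenvalues of distinct absolute values has an eigenbasis
ordered by strictly decreasing absolute value of the eigenvalue. -/
theorem exists_basis_strictAnti_abs {M : Type*} [AddCommGroup M] [Module ℝ M]
    [FiniteDimensional ℝ M] {n : ℕ} (hn : finrank ℝ M = n) (A : End ℝ M) (S : Finset ℝ)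
    (hS : S.card = n) (hSA : ∀ μ ∈ S, A.HasEigenvalue μ) (hinj : Set.InjOn (fun x : ℝ ↦ |x|) S) :
    ∃ (b : Basis (Fin n) ℝ M) (l : Fin n → ℝ), (∀ i, l i ∈ S) ∧ (∀ i, A (b i) = l i • b i) ∧
      StrictAnti fun i ↦ |l i| := by
  classical
  let T : Finset ℝ := S.image fun x ↦ |x|
  have hT : T.card = n := (Finset.card_image_of_injOn hinj).trans hS
  -- `orderEmbOfFin` enumerates increasingly, so `i.rev` gives the decreasing order.
  have hmem : ∀ i : Fin n, ∃ x ∈ S, |x| = T.orderEmbOfFin hT i.rev := fun i ↦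
    Finset.mem_image.1 (T.orderEmbOfFin_mem hT i.rev)
  choose l hlS hl using hmem
  have hanti : StrictAnti fun i ↦ |l i| := fun i k hik ↦ by
    simp only [hl]
    exact (T.orderEmbOfFin hT).strictMono (Fin.rev_lt_rev.2 hik)
  have hlinj : Function.Injective l := fun i k h ↦ hanti.injective (by simp only [h])
  choose v hv using fun i ↦ (hSA _ (hlS i)).exists_hasEigenvector
  have hind := End.eigenvectors_linearIndependent' A l hlinj v hv
  rcases n with _ | n
  · have : Subsingleton M := finrank_zero_iff.1 hn
    exact ⟨Basis.empty M, l, hlS, fun i ↦ i.elim0, hanti⟩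
  · refine ⟨basisOfLinearIndependentOfCardEqFinrank hind (by simp [hn]), l, hlS, fun i ↦ ?_, hanti⟩
    simpa using (hv i).apply_eq_smul

/-! ### From complex eigenvalues to real roots, and the conclusion -/

theorem isEigenvalue_of_isRoot_charpoly {n : ℕ}
    (A : EuclideanSpace ℝ (Fin n) →ₗ[ℝ] EuclideanSpace ℝ (Fin n)) {μ : ℝ}
    (h : A.charpoly.IsRoot μ) : IsEigenvalue A μ := by
  rw [IsEigenvalue, End.hasEigenvalue_iff_isRoot_charpoly, LinearMap.charpoly_baseChange]
  exact h.map (f := algebraMap ℝ ℂ)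

theorem rootMultiplicity_eq_one_of_isSimpleEigenvalue {n : ℕ}
    (A : EuclideanSpace ℝ (Fin n) →ₗ[ℝ] EuclideanSpace ℝ (Fin n)) {μ : ℝ}
    (h : IsSimpleEigenvalue A μ) : A.charpoly.rootMultiplicity μ = 1 := by
  rw [IsSimpleEigenvalue, LinearMap.charpoly_baseChange] at h
  rw [← h]
  exact Polynomial.eq_rootMultiplicity_map (algebraMap ℝ ℂ).injective μ

theorem proposition18 (n : ℕ)
    (A : EuclideanSpace ℝ (Fin n) →ₗ[ℝ] EuclideanSpace ℝ (Fin n))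
    (hreal : ∀ μ : ℂ, IsEigenvalue A μ → μ.im = 0) :
    (∃ K : TotallyPositiveStructure n, IsGSRWith K A) ∧
    ((∀ μ : ℂ, IsEigenvalue A μ → μ ≠ 0 ∧ IsSimpleEigenvalue A μ) →
      (∀ μ ν : ℂ, IsEigenvalue A μ → IsEigenvalue A ν → μ ≠ ν → ‖μ‖ ≠ ‖ν‖) →
      ∃ K : TotallyPositiveStructure n, IsGSSRWith K A) := by
  have hsplit := charpoly_splits_of_isEigenvalue_im_eq_zero A hreal
  refine ⟨?_, fun hsimple habs ↦ ?_⟩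
  · choose ε K hε hK hKA using fun i : Fin n ↦
      exists_signed_invariant_cone (V := ExtPow n (i + 1)) (exteriorPower.map (i + 1) A)
        (iSup_maxGenEigenspace_exteriorPower_map _ A
          (iSup_maxGenEigenspace_eq_top_of_splits A hsplit))
    exact ⟨⟨K, hK⟩, ε, hε, hKA⟩
  · have hroot : ∀ μ ∈ A.charpoly.roots, A.charpoly.IsRoot μ := fun μ hμ ↦
      Polynomial.isRoot_of_mem_roots hμ
    have hnodup : A.charpoly.roots.Nodup := by
      rw [Multiset.nodup_iff_count_le_one]
      intro μ
      by_cases hμ : μ ∈ A.charpoly.roots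
      · rw [Polynomial.count_roots, rootMultiplicity_eq_one_of_isSimpleEigenvalue A
          (hsimple _ (isEigenvalue_of_isRoot_charpoly A (hroot μ hμ))).2]
      · simp [Multiset.count_eq_zero_of_notMem hμ]
    -- A split polynomial of degree `n` with simple roots has `n` distinct ones.
    have hcard : A.charpoly.roots.toFinset.card = n := by
      rw [Multiset.toFinset_card_of_nodup hnodup, ← hsplit.natDegree_eq_card_roots,
        LinearMap.charpoly_natDegree, finrank_euclideanSpace_fin]
    obtain ⟨b, l, hlS, hb, hanti⟩ := exists_basis_strictAnti_abs finrank_euclideanSpace_fin A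
      A.charpoly.roots.toFinset hcard
      (fun μ hμ ↦ (End.hasEigenvalue_iff_isRoot_charpoly A μ).2
        (hroot μ (Multiset.mem_toFinset.1 hμ)))
      (fun μ hμ ν hν h ↦ by
        by_contra hne
        refine habs μ ν
          (isEigenvalue_of_isRoot_charpoly A (hroot μ (Multiset.mem_toFinset.1 hμ)))
          (isEigenvalue_of_isRoot_charpoly A (hroot ν (Multiset.mem_toFinset.1 hν)))
          (by exact_mod_cast hne) ?_
        simpa using h)
    have hl0 : ∀ i, l i ≠ 0 := fun i ↦ by
      exact_mod_cast (hsimple _ (isEigenvalue_of_isRoot_charpoly A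
        (hroot _ (Multiset.mem_toFinset.1 (hlS i))))).1
    choose ε K hε hK hKA using fun i : Fin n ↦
      exists_signed_positive_cone_exteriorPower (j := i + 1) (Nat.succ_le_of_lt i.isLt) b A l hb
        hl0 hanti
    exact ⟨⟨K, hK⟩, ε, hε, hKA⟩
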